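/- Let $N$ be a square-free positive integer, let $d$ be a positive integer with $d\equiv 0$ or $1 \pmod 4$ that is not the square of an integer, and write $[a,b,c]$ for the quadratic form $ax^2+bxy+cy^2$ with $a,b,c\in\mathbb Z$, of discriminant $b^2-4ac$; it is primitive if $\gcd(a,b,c)=1$ (if its discriminant is positive, it is indefinite). For a subgroup $G$ of $SL_2(\mathbb Z)$, the forms $[a,b,c]$ and $[a',b',c']$ are $G$-equivalent if $$\begin{pmatrix}a'&b'/2\\ b'/2&c'\end{pmatrix}=\gamma^t\begin{pmatrix}a&b/2\\ b/2&c\end{pmatrix}\gamma$$ for some $\gamma\in G$. For a positive non-square integer $D\equiv 0,1\pmod 4$, let $h_D$ be the number of $SL_2(\mathbb Z)$-equivalence classes of primitive (indefinite) forms of discriminant $D$. Let $H_d$ be the number of $\Gamma_0(N)$-equivalence classes of primitive (indefinite) forms of discriminant $d$. For a prime $p$ let $\left(\frac dp\right)$ be the Kronecker symbol, that is, the Legendre symbol (with value $0$ if $p\mid d$) if $p$ is odd, while $\left(\frac d2\right)$ is $0$ if $d$ is even, $1$ if $d\equiv \pm1\pmod 8$, and $-1$ if $d\equiv\pm3\pmod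 8$. The numbers of classes that occur here and below are all finite. For every positive divisor $k$ of $N$, the number of $\Gamma_0(N)$-equivalence classes of primitive (indefinite) forms $[a,b,c]$ of discriminant $d$ with $\gcd(a,N)=k$ is equal to $$h_{d_1}\prod_{p\mid k}\left(1+\left(\frac dp\right)\right),\qquad d_1=\frac{dN^2}{k^2},$$ where the product is over the primes $p$ dividing $k$. Consequently, $$H_d=\sum_{k\mid N}h_{d(N/k)^2}\prod_{p\mid k}\left(1+\left(\frac dp\right)\right).$$ -/

import Mathlib

open scoped MatrixGroups

/-- The quadratic form `[a, b, c] = a x² + b x y + c y²` with integer coefficients. -/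
@[ext]
structure BinForm where
  a : ℤ
  b : ℤ
  c : ℤ

/-- The set of positive integers `d ≡ 0, 1 (mod 4)` that are not the square of an integer. -/
def Omega : Set ℤ := {d | 0 < d ∧ (d % 4 = 0 ∨ d % 4 = 1) ∧ ¬ IsSquare d}

/-- The Kronecker symbol `(d/p)` at a prime `p`: the Legendre symbol for odd `p`; for `p = 2`
it is `0` if `d` is even, `1` if `d ≡ ±1 (mod 8)` and `-1` if `d ≡ ±3 (mod 8)`. -/
def kroneckerAtPrime (d : ℤ) (p : ℕ) : ℤ :=
  if p = 2 then ZMod.χ₈ (d : ZMod 8) else jacobiSym d p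

namespace BinForm

def disc (Q : BinForm) : ℤ := Q.b ^ 2 - 4 * Q.a * Q.c

/-- `[a, b, c]` is primitive (and indefinite) if `(a, b, c) = 1` and its discriminant lies
in `Omega`. As the discriminant is positive, such a form is indefinite. -/
def IsPrimitive (Q : BinForm) : Prop :=
  Int.gcd Q.a (Int.gcd Q.b Q.c) = 1 ∧ Q.disc ∈ Omega

/-- The symmetric matrix of `[a, b, c]`. -/
def toMatrix (Q : BinForm) : Matrix (Fin 2) (Fin 2) ℚ :=
  !![(Q.a : ℚ), (Q.b : ℚ) / 2; (Q.b : ℚ) / 2, (Q.c : ℚ)]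

/-- `Q` and `Q'` are equivalent in the subgroup `G` of `SL₂(ℤ)` if the matrix of `Q'` is
`γᵗ M γ` for some `γ ∈ G`, where `M` is the matrix of `Q`. -/
def EquivIn (G : Subgroup SL(2, ℤ)) (Q Q' : BinForm) : Prop :=
  ∃ γ ∈ G, Q'.toMatrix =
    ((γ : Matrix (Fin 2) (Fin 2) ℤ).map (Int.cast : ℤ → ℚ)).transpose * Q.toMatrix *
      (γ : Matrix (Fin 2) (Fin 2) ℤ).map (Int.cast : ℤ → ℚ)

theorem map_mul_cast (A B : Matrix (Fin 2) (Fin 2) ℤ) :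
    (A * B).map (Int.cast : ℤ → ℚ) = A.map (Int.cast : ℤ → ℚ) * B.map (Int.cast : ℤ → ℚ) :=
  Matrix.map_mul (f := Int.castRingHom ℚ)

theorem map_one_cast :
    (1 : Matrix (Fin 2) (Fin 2) ℤ).map (Int.cast : ℤ → ℚ) = 1 :=
  Matrix.map_one _ Int.cast_zero Int.cast_one

theorem EquivIn.refl (G : Subgroup SL(2, ℤ)) (Q : BinForm) : EquivIn G Q Q :=
  ⟨1, G.one_mem, by simp⟩

theorem EquivIn.symm {G : Subgroup SL(2, ℤ)} {Q Q' : BinForm} (h : EquivIn G Q Q') :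
    EquivIn G Q' Q := by
  obtain ⟨γ, hγ, h⟩ := h
  have e : (γ : Matrix (Fin 2) (Fin 2) ℤ).map (Int.cast : ℤ → ℚ) *
      ((γ⁻¹ : SL(2, ℤ)) : Matrix (Fin 2) (Fin 2) ℤ).map (Int.cast : ℤ → ℚ) = 1 := by
    rw [← map_mul_cast, ← Matrix.SpecialLinearGroup.coe_mul, mul_inv_cancel,
      Matrix.SpecialLinearGroup.coe_one, map_one_cast]
  refine ⟨γ⁻¹, G.inv_mem hγ, ?_⟩
  have e' := congrArg Matrix.transpose e
  rw [Matrix.transpose_mul, Matrix.transpose_one] at e'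
  rw [h, Matrix.mul_assoc, Matrix.mul_assoc _ _ (Matrix.map _ _), e, Matrix.mul_one,
    ← Matrix.mul_assoc, e', Matrix.one_mul]

theorem EquivIn.trans {G : Subgroup SL(2, ℤ)} {Q Q' Q'' : BinForm} (h : EquivIn G Q Q')
    (h' : EquivIn G Q' Q'') : EquivIn G Q Q'' := by
  obtain ⟨γ, hγ, h⟩ := h
  obtain ⟨δ, hδ, h'⟩ := h'
  refine ⟨γ * δ, G.mul_mem hγ hδ, ?_⟩
  rw [h', h, Matrix.SpecialLinearGroup.coe_mul, map_mul_cast, Matrix.transpose_mul]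
  simp only [Matrix.mul_assoc]

/-- Equivalence in `G`, restricted to a set `S` of forms. -/
def equivSetoid (G : Subgroup SL(2, ℤ)) (S : Set BinForm) : Setoid S where
  r Q Q' := EquivIn G Q Q'
  iseqv := ⟨fun Q => EquivIn.refl G Q, EquivIn.symm, EquivIn.trans⟩

/-- The classes, under equivalence in `G`, of the forms in the set `S`. -/
def Classes (G : Subgroup SL(2, ℤ)) (S : Set BinForm) : Type :=
  Quotient (equivSetoid G S)

/-- The primitive indefinite forms of discriminant `d`. -/
def primForms (d : ℤ) : Set BinForm := {Q | Q.IsPrimitive ∧ Q.disc = d}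

/-- The primitive indefinite forms `[a, b, c]` of discriminant `d` with `(a, N) = k`. -/
def primFormsGcd (d : ℤ) (N k : ℕ) : Set BinForm :=
  {Q | Q ∈ primForms d ∧ Int.gcd Q.a N = k}

/-- The class number `h_d`: the number of `SL₂(ℤ)`-classes of primitive indefinite forms
of discriminant `d`. -/
noncomputable def classNumber (d : ℤ) : ℕ := Nat.card (Classes ⊤ (primForms d))

/-- `H_d`: the number of `Γ₀(N)`-classes of primitive indefinite forms of discriminant `d`. -/
noncomputable def levelClassNumber (N : ℕ) (d : ℤ) : ℕ :=
  Nat.card (Classes (CongruenceSubgroup.Gamma0 N) (primForms d))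

end BinForm

/-!
Write `M = N / k`; as `N` is square-free, `k` and `M` are coprime. The count is obtained in two
steps.

*Reduction to `N ∣ a`.* Let `W` be an Atkin–Lehner matrix of determinant `M` and level `N`. It
normalizes `Γ₀(N)`, and `Q ↦ Q ∘ W` carries the primitive forms of discriminant `d` with
`(a, N) = k` bijectively onto the primitive forms of discriminant `d M²` with `N ∣ a`; the inverse
is `F ↦ M⁻² (F ∘ adj W)`, whose integrality (`exists_subst_atkinLehner_eq`) rests on `M` being
square-free and on `d ≡ 0, 1 (mod 4)` when `M` is even. So both sets have equally many
`Γ₀(N)`-classes (`nonempty_classes_primFormsGcd_equiv`).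

*The case `N ∣ a`, for a discriminant `D`.* The residue of `b` modulo `2 N` is an invariant of the
`Γ₀(N)`-class and satisfies `b² ≡ D (mod 4 N)`. A `Γ₀(N)`-class is determined by its
`SL₂(ℤ)`-class together with this residue, and every such pair occurs
(`classAndRoot_bijective`): an `SL₂(ℤ)`-equivalence of forms with the same residue lies in `Γ₀(N)`
because the forms are primitive, and any residue is reached from a form in the class whose leading
coefficient is coprime to `N`. The number of residues is `∏ (1 + (D / p))` over the primes
`p ∣ N`, by the Chinese remainder theorem (`card_discRoots`). For `D = d M²` the factors at
`p ∣ M` are `1`, and those at `p ∣ k` are `1 + (d / p)`.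

Finiteness follows from reduction theory (`finite_classes_top`), and the formula for `H_d` by
sorting the classes by the invariant `(a, N)`.
-/

namespace BinForm

/-! ### Substitution of an integer matrix into a form -/

/-- The form `Q ∘ A`, that is `(x, y) ↦ Q (A (x, y)ᵗ)`, for an integer matrix `A` of any
determinant. -/
def subst (Q : BinForm) (A : Matrix (Fin 2) (Fin 2) ℤ) : BinForm where
  a := Q.a * A 0 0 ^ 2 + Q.b * A 0 0 * A 1 0 + Q.c * A 1 0 ^ 2
  b := 2 * Q.a * A 0 0 * A 0 1 + Q.b * (A 0 0 * A 1 1 + A 0 1 * A 1 0) + 2 * Q.c * A 1 0 * A 1 1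
  c := Q.a * A 0 1 ^ 2 + Q.b * A 0 1 * A 1 1 + Q.c * A 1 1 ^ 2

theorem subst_subst (Q : BinForm) (A B : Matrix (Fin 2) (Fin 2) ℤ) :
    (Q.subst A).subst B = Q.subst (A * B) := by
  ext <;> simp [subst, Matrix.mul_apply, Fin.sum_univ_two] <;> ring

theorem disc_subst (Q : BinForm) (A : Matrix (Fin 2) (Fin 2) ℤ) :
    (Q.subst A).disc = Q.disc * A.det ^ 2 := by
  simp only [subst, disc, Matrix.det_fin_two]
  ring

theorem subst_one (Q : BinForm) : Q.subst 1 = Q := by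
  ext <;> simp [subst]

theorem det_sl (g : SL(2, ℤ)) : g 0 0 * g 1 1 - g 0 1 * g 1 0 = 1 := by
  have := g.det_coe
  rwa [Matrix.det_fin_two] at this

theorem equivIn_iff {G : Subgroup SL(2, ℤ)} {Q Q' : BinForm} :
    EquivIn G Q Q' ↔ ∃ g ∈ G, Q' = Q.subst g := by
  refine exists_congr fun g => and_congr_right fun _ => ?_
  constructor
  · intro h
    have h00 := congrFun (congrFun h 0) 0
    have h01 := congrFun (congrFun h 0) 1
    have h11 := congrFun (congrFun h 1) 1
    simp only [toMatrix, Matrix.mul_apply, Fin.sum_univ_two, Matrix.transpose_apply,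
      Matrix.map_apply, Matrix.of_apply, Matrix.cons_val', Matrix.cons_val_zero,
      Matrix.cons_val_one, Matrix.cons_val_fin_one] at h00 h01 h11
    ext
    · have : (Q'.a : ℚ) = ((Q.subst g).a : ℤ) := by
        rw [h00]; simp only [subst]; push_cast; ring
      exact_mod_cast this
    · have : (Q'.b : ℚ) = ((Q.subst g).b : ℤ) := by
        rw [← div_left_inj' (two_ne_zero' ℚ), h01]
        simp only [subst]; push_cast; ring
      exact_mod_cast this
    · have : (Q'.c : ℚ) = ((Q.subst g).c : ℤ) := by
        rw [h11]; simp only [subst]; push_cast; ring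
      exact_mod_cast this
  · rintro rfl
    ext i j
    fin_cases i <;> fin_cases j <;>
      simp [toMatrix, subst, Matrix.mul_apply, Fin.sum_univ_two] <;> ring

/-- An integer dividing `n * Q.a`, `n * Q.b` and `n * Q.c` divides `n` if `Q` is primitive. -/
theorem dvd_of_dvd_mul_coeffs {Q : BinForm} (hQ : Int.gcd Q.a (Int.gcd Q.b Q.c) = 1) {m n : ℤ}
    (ha : m ∣ n * Q.a) (hb : m ∣ n * Q.b) (hc : m ∣ n * Q.c) : m ∣ n := by
  have h1 := Int.gcd_eq_gcd_ab Q.a (Int.gcd Q.b Q.c)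
  rw [hQ, Int.gcd_eq_gcd_ab Q.b Q.c] at h1
  push_cast at h1
  rw [← mul_one n, h1]
  obtain ⟨r, hr⟩ := ha
  obtain ⟨s, hs⟩ := hb
  obtain ⟨t, ht⟩ := hc
  rw [mul_add, ← mul_assoc, hr, ← mul_assoc, mul_add, ← mul_assoc, ← mul_assoc, hs, ht]
  exact dvd_add (Dvd.intro _ (by rw [mul_assoc]))
    ((dvd_add (Dvd.intro _ (by rw [mul_assoc])) (Dvd.intro _ (by rw [mul_assoc]))).mul_right _)

theorem gcd_coeffs_eq_one_iff (Q : BinForm) :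
    Int.gcd Q.a (Int.gcd Q.b Q.c) = 1 ↔ ∀ p : ℕ, p.Prime → (p : ℤ) ∣ Q.a → (p : ℤ) ∣ Q.b →
      ¬ (p : ℤ) ∣ Q.c := by
  constructor
  · intro h p hp ha hb hc
    have := dvd_of_dvd_mul_coeffs h (m := p) (n := 1) (by simpa) (by simpa) (by simpa)
    exact hp.one_lt.ne' (by exact_mod_cast Int.eq_one_of_dvd_one (by positivity) this)
  · intro h
    by_contra hne
    obtain ⟨p, hp, hd⟩ := Nat.exists_prime_and_dvd hne
    have h1 : (p : ℤ) ∣ Int.gcd Q.a (Int.gcd Q.b Q.c) := by exact_mod_cast hd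
    have h2 := h1.trans (Int.gcd_dvd_right _ _)
    exact h p hp (h1.trans (Int.gcd_dvd_left _ _)) (h2.trans (Int.gcd_dvd_left _ _))
      (h2.trans (Int.gcd_dvd_right _ _))

theorem dvd_subst {Q : BinForm} {m : ℤ} (ha : m ∣ Q.a) (hb : m ∣ Q.b) (hc : m ∣ Q.c)
    (A : Matrix (Fin 2) (Fin 2) ℤ) :
    m ∣ (Q.subst A).a ∧ m ∣ (Q.subst A).b ∧ m ∣ (Q.subst A).c := by
  obtain ⟨r, hr⟩ := ha
  obtain ⟨s, hs⟩ := hb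
  obtain ⟨t, ht⟩ := hc
  simp only [subst, hr, hs, ht]
  exact ⟨⟨(subst ⟨r, s, t⟩ A).a, by simp only [subst]; ring⟩,
    ⟨(subst ⟨r, s, t⟩ A).b, by simp only [subst]; ring⟩,
    ⟨(subst ⟨r, s, t⟩ A).c, by simp only [subst]; ring⟩⟩

theorem subst_inv {Q Q' : BinForm} {g : SL(2, ℤ)} (h : Q' = Q.subst g) :
    Q = Q'.subst (g⁻¹ : SL(2, ℤ)) := by
  rw [h, subst_subst, ← Matrix.SpecialLinearGroup.coe_mul, mul_inv_cancel,
    Matrix.SpecialLinearGroup.coe_one, subst_one]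

theorem subst_mem_primForms {D : ℤ} {Q : BinForm} (hQ : Q ∈ primForms D) (g : SL(2, ℤ)) :
    Q.subst g ∈ primForms D := by
  have hd : (Q.subst g).disc = Q.disc := by rw [disc_subst, g.det_coe]; ring
  refine ⟨⟨?_, hd ▸ hQ.1.2⟩, hd.trans hQ.2⟩
  rw [gcd_coeffs_eq_one_iff]
  intro p hp ha hb hc
  have := dvd_subst ha hb hc (g⁻¹ : SL(2, ℤ))
  rw [← subst_inv rfl] at this
  exact (gcd_coeffs_eq_one_iff Q).1 hQ.1.1 p hp this.1 this.2.1 this.2.2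

/-- The translate `Q (x + n y, y)`. -/
theorem equivIn_top_translate (Q : BinForm) (n : ℤ) :
    EquivIn ⊤ Q ⟨Q.a, Q.b + 2 * Q.a * n, Q.a * n ^ 2 + Q.b * n + Q.c⟩ := by
  refine equivIn_iff.2 ⟨⟨!![1, n; 0, 1], by simp [Matrix.det_fin_two]⟩, trivial, ?_⟩
  ext
  · simp [subst]
  · simp [subst]; ring
  · simp [subst]

/-- The form `Q (-y, x)`. -/
theorem equivIn_top_swap (Q : BinForm) : EquivIn ⊤ Q ⟨Q.c, -Q.b, Q.a⟩ := by
  refine equivIn_iff.2 ⟨⟨!![0, -1; 1, 0], by simp [Matrix.det_fin_two]⟩, trivial, ?_⟩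
  ext <;> simp [subst]

theorem mem_primForms_of_equivIn {G : Subgroup SL(2, ℤ)} {D : ℤ} {Q Q' : BinForm}
    (hQ : Q ∈ primForms D) (h : EquivIn G Q Q') : Q' ∈ primForms D := by
  obtain ⟨g, -, rfl⟩ := equivIn_iff.1 h
  exact subst_mem_primForms hQ g

theorem equivIn_top {G : Subgroup SL(2, ℤ)} {Q Q' : BinForm} (h : EquivIn G Q Q') :
    EquivIn ⊤ Q Q' := by
  obtain ⟨g, -, h⟩ := h
  exact ⟨g, trivial, h⟩

/-! ### Finiteness of the class number -/

theorem a_ne_zero {D : ℤ} {Q : BinForm} (hQ : Q ∈ primForms D) : Q.a ≠ 0 := by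
  intro h
  apply hQ.1.2.2.2
  exact ⟨Q.b, by simp only [disc, h]; ring⟩

/-- A form whose leading coefficient is least in absolute value within its class can be
translated to one with `|b| ≤ |a| ≤ |c|`. -/
theorem exists_equivIn_top_reduced {D : ℤ} {Q : BinForm} (hQ : Q ∈ primForms D) :
    ∃ Q', EquivIn ⊤ Q Q' ∧ |Q'.b| ≤ |Q'.a| ∧ |Q'.a| ≤ |Q'.c| := by
  classical
  have hex : ∃ n : ℕ, ∃ Q', EquivIn ⊤ Q Q' ∧ Q'.a.natAbs = n := ⟨_, Q, EquivIn.refl _ _, rfl⟩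
  obtain ⟨R, hR, hRa⟩ := Nat.find_spec hex
  have hmin : ∀ Q', EquivIn ⊤ Q Q' → R.a.natAbs ≤ Q'.a.natAbs := fun Q' h => by
    rw [hRa]; exact Nat.find_min' hex ⟨Q', h, rfl⟩
  have ha : R.a ≠ 0 := a_ne_zero (mem_primForms_of_equivIn hQ hR)
  obtain ⟨n, hn⟩ : ∃ n : ℤ, |R.b + 2 * R.a * n| ≤ |R.a| := by
    have hpos : 0 < |R.a| := abs_pos.2 ha
    have e1 := Int.emod_add_mul_ediv (R.b + |R.a|) (2 * |R.a|)
    have e2 := Int.emod_nonneg (R.b + |R.a|) (show 2 * |R.a| ≠ 0 by positivity)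
    have e3 := Int.emod_lt_of_pos (R.b + |R.a|) (show 0 < 2 * |R.a| by positivity)
    set q := (R.b + |R.a|) / (2 * |R.a|)
    have key : |R.b - 2 * |R.a| * q| ≤ |R.a| := by rw [abs_le]; constructor <;> linarith
    rcases abs_choice R.a with h | h
    · refine ⟨-q, ?_⟩
      convert key using 2; rw [h]; ring
    · refine ⟨q, ?_⟩
      convert key using 2; rw [h]; ring
  have hT := hR.trans (equivIn_top_translate R n)
  refine ⟨_, hT, hn, ?_⟩
  have := hmin _ (hT.trans (equivIn_top_swap _))
  rw [Int.abs_eq_natAbs, Int.abs_eq_natAbs]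
  exact_mod_cast this

theorem finite_classes_top (D : ℤ) : Finite (Classes ⊤ (primForms D)) := by
  let S : Set (ℤ × ℤ × ℤ) := Set.Icc (-D) D ×ˢ Set.Icc (-D) D ×ˢ Set.Icc (-D) D
  have hS : S.Finite := (Set.finite_Icc _ _).prod ((Set.finite_Icc _ _).prod (Set.finite_Icc _ _))
  let T : Set (primForms D) := {Q | (Q.1.a, Q.1.b, Q.1.c) ∈ S}
  have hT : T.Finite := by
    refine Set.Finite.preimage (f := fun Q : primForms D => (Q.1.a, Q.1.b, Q.1.c)) ?_ hS
    intro Q _ Q' _ h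
    simp only [Prod.mk.injEq] at h
    exact Subtype.ext (BinForm.ext h.1 h.2.1 h.2.2)
  have : Finite T := hT
  refine Finite.of_surjective (fun Q : T => (Quotient.mk (equivSetoid ⊤ (primForms D)) Q.1)) ?_
  intro q
  induction q using Quotient.inductionOn with
  | h Q =>
    obtain ⟨Q', hQ', hb, hc⟩ := exists_equivIn_top_reduced Q.2
    have hp := mem_primForms_of_equivIn Q.2 hQ'
    refine ⟨⟨⟨Q', hp⟩, ?_⟩, Quotient.sound (s := equivSetoid _ _) hQ'.symm⟩
    have hd : Q'.b ^ 2 - 4 * Q'.a * Q'.c = D := hp.2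
    have hD : 0 < D := hp.2 ▸ hp.1.2.1
    have ha : 0 < |Q'.a| := abs_pos.2 (a_ne_zero hp)
    have hac : |Q'.a * Q'.c| = |Q'.a| * |Q'.c| := abs_mul _ _
    have hb2 : Q'.b ^ 2 ≤ |Q'.a| * |Q'.c| := by
      rw [← sq_abs]; nlinarith [abs_nonneg Q'.b]
    -- `a c` is negative, as otherwise `b ^ 2 ≤ a c` makes the discriminant nonpositive
    have hneg : |Q'.a * Q'.c| = -(Q'.a * Q'.c) := by
      apply abs_of_nonpos
      by_contra! h
      rw [← hac, abs_of_pos h] at hb2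
      nlinarith
    have h4 : |Q'.a| * |Q'.c| ≤ D := by nlinarith [sq_nonneg Q'.b]
    have hcD : |Q'.c| ≤ D := by nlinarith [abs_nonneg Q'.c]
    exact ⟨abs_le.1 (hc.trans hcD), abs_le.1 ((hb.trans hc).trans hcD), abs_le.1 hcD⟩

end BinForm

/-! ### The roots of `X² + D X + (D² - D) / 4` modulo a square-free number -/

/-- The roots in `ZMod N` of `X² + D X + (D² - D) / 4`, a polynomial of discriminant `D`
(the division is exact for `D ≡ 0, 1 (mod 4)`). In terms of `β = D + 2 X`, these are the
`β` modulo `2 N` with `β² ≡ D (mod 4 N)`. -/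
def discRoots (D : ℤ) (N : ℕ) : Set (ZMod N) :=
  {x | x ^ 2 + (D : ZMod N) * x + (((D ^ 2 - D) / 4 : ℤ) : ZMod N) = 0}

theorem four_mul_ediv_sq_sub {D : ℤ} (hD : D % 4 = 0 ∨ D % 4 = 1) :
    4 * ((D ^ 2 - D) / 4) = D ^ 2 - D := by
  apply Int.mul_ediv_cancel'
  rcases hD with h | h
  · obtain ⟨t, ht⟩ := Int.dvd_of_emod_eq_zero h
    exact ⟨t * (4 * t - 1), by rw [ht]; ring⟩
  · obtain ⟨t, ht⟩ : ∃ t, D = 4 * t + 1 := ⟨D / 4, by omega⟩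
    exact ⟨t * (4 * t + 1), by rw [ht]; ring⟩

theorem card_discRoots_mul (D : ℤ) {m n : ℕ} (h : m.Coprime n) :
    Nat.card (discRoots D (m * n)) = Nat.card (discRoots D m) * Nat.card (discRoots D n) := by
  rw [← Nat.card_prod]
  let e := ZMod.chineseRemainder h
  refine Nat.card_congr ((e.toEquiv.subtypeEquiv (q := fun x => x.1 ∈ discRoots D m ∧
    x.2 ∈ discRoots D n) fun x => ?_).trans (Equiv.subtypeProdEquivProd
    (p := (· ∈ discRoots D m)) (q := (· ∈ discRoots D n))))
  simp only [discRoots, Set.mem_ofPred_eq]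
  rw [← e.map_eq_zero_iff, Prod.ext_iff]
  simp [RingEquiv.toEquiv_eq_coe]

theorem card_discRoots_two {D : ℤ} (hD : D % 4 = 0 ∨ D % 4 = 1) :
    (Nat.card (discRoots D 2) : ℤ) = 1 + kroneckerAtPrime D 2 := by
  classical
  obtain ⟨t, r, rfl, hr⟩ : ∃ t r : ℤ, D = 8 * t + r ∧ (r = 0 ∨ r = 1 ∨ r = 4 ∨ r = 5) :=
    ⟨D / 8, D % 8, by omega, by omega⟩
  have h8 : ((8 * t + r : ℤ) : ZMod 8) = (r : ZMod 8) := by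
    push_cast
    rw [show (8 : ZMod 8) = 0 from rfl, zero_mul, zero_add]
  have h2 : ((8 * t + r : ℤ) : ZMod 2) = (r : ZMod 2) := by
    push_cast
    rw [show (8 : ZMod 2) = 0 from rfl, zero_mul, zero_add]
  have hq : ((((8 * t + r) ^ 2 - (8 * t + r)) / 4 : ℤ) : ZMod 2) =
      (((r ^ 2 - r) / 4 : ℤ) : ZMod 2) := by
    have : ((8 * t + r) ^ 2 - (8 * t + r)) / 4 =
        (r ^ 2 - r) / 4 + 2 * (8 * t ^ 2 + 2 * t * r - t) := by
      rw [← Int.add_mul_ediv_right _ _ (by norm_num : (4 : ℤ) ≠ 0)]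
      congr 1; ring
    rw [this]
    push_cast
    rw [show (2 : ZMod 2) = 0 from rfl, zero_mul, add_zero]
  have hcard : Nat.card (discRoots (8 * t + r) 2) = (Finset.univ.filter fun x : ZMod 2 =>
      x ^ 2 + (r : ZMod 2) * x + (((r ^ 2 - r) / 4 : ℤ) : ZMod 2) = 0).card := by
    rw [Nat.card_coe_set_eq, ← Set.ncard_coe_finset]
    congr 1
    ext x
    simp only [discRoots, Set.mem_ofPred_eq, Finset.coe_filter, Finset.mem_univ, true_and, h2, hq]
  rw [hcard, kroneckerAtPrime, if_pos rfl, h8]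
  rcases hr with rfl | rfl | rfl | rfl <;> decide

theorem card_discRoots_prime {D : ℤ} (hD : D % 4 = 0 ∨ D % 4 = 1) {p : ℕ} (hp : p.Prime) :
    (Nat.card (discRoots D p) : ℤ) = 1 + kroneckerAtPrime D p := by
  classical
  by_cases h2 : p = 2
  · subst h2; exact card_discRoots_two hD
  have : Fact p.Prime := ⟨hp⟩
  have hne : (2 : ZMod p) ≠ 0 := by
    intro h
    have : (p : ℕ) ∣ 2 := (ZMod.natCast_eq_zero_iff 2 p).1 (by exact_mod_cast h)
    exact h2 ((Nat.prime_dvd_prime_iff_eq hp Nat.prime_two).1 this)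
  rw [kroneckerAtPrime, if_neg h2, ← jacobiSym.legendreSym.to_jacobiSym, add_comm,
    ← legendreSym.card_sqrts p h2, ← Nat.card_eq_card_toFinset]
  congr 1
  -- completing the square: `y = 2 x + D`
  have h4 : (4 : ZMod p) * (((D ^ 2 - D) / 4 : ℤ) : ZMod p) = (D : ZMod p) ^ 2 - D := by
    exact_mod_cast congrArg (Int.cast : ℤ → ZMod p) (four_mul_ediv_sq_sub hD)
  refine Nat.card_congr (((Equiv.mulLeft₀ (2 : ZMod p) hne).trans
    (Equiv.addRight (D : ZMod p))).subtypeEquiv fun x => ?_)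
  change x ^ 2 + (D : ZMod p) * x + (((D ^ 2 - D) / 4 : ℤ) : ZMod p) = 0 ↔
    (2 * x + (D : ZMod p)) ^ 2 = D
  constructor
  · intro h
    linear_combination 4 * h - h4
  · intro h
    have : (4 : ZMod p) ≠ 0 := by
      rw [show (4 : ZMod p) = 2 * 2 by norm_num]; exact mul_ne_zero hne hne
    refine (mul_eq_zero.1 (?_ : (4 : ZMod p) * _ = 0)).resolve_left this
    linear_combination h + h4

theorem card_discRoots {D : ℤ} (hD : D % 4 = 0 ∨ D % 4 = 1) {N : ℕ} (hN : Squarefree N) :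
    (Nat.card (discRoots D N) : ℤ) = ∏ p ∈ N.primeFactors, (1 + kroneckerAtPrime D p) := by
  induction N using induction_on_primes with
  | zero => exact absurd hN not_squarefree_zero
  | one =>
    have : discRoots D 1 = Set.univ := Set.eq_univ_of_forall fun x => Subsingleton.elim _ _
    rw [this]
    simp
  | prime_mul p m hp ih =>
    have hcop := Nat.coprime_of_squarefree_mul hN
    rw [card_discRoots_mul D hcop, hcop.primeFactors_mul, Finset.prod_union
      hcop.disjoint_primeFactors, hp.primeFactors, Finset.prod_singleton, Nat.cast_mul,
      card_discRoots_prime hD hp, ih (hN.squarefree_of_dvd (dvd_mul_left _ _))]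

theorem kroneckerAtPrime_mul_sq_of_dvd (d : ℤ) {p M : ℕ} (hp : p.Prime) (h : p ∣ M) :
    kroneckerAtPrime (d * (M : ℤ) ^ 2) p = 0 := by
  obtain ⟨t, rfl⟩ := h
  unfold kroneckerAtPrime
  split_ifs with h2
  · subst h2
    have : ∀ x : ZMod 8, ZMod.χ₈ (4 * x) = 0 := by decide
    rw [← this ((d * t ^ 2 : ℤ) : ZMod 8)]
    congr 1; push_cast; ring
  · have : Fact p.Prime := ⟨hp⟩
    rw [← jacobiSym.legendreSym.to_jacobiSym, legendreSym.eq_zero_iff]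
    push_cast; simp

theorem kroneckerAtPrime_mul_sq_of_not_dvd (d : ℤ) {p M : ℕ} (hp : p.Prime) (h : ¬ p ∣ M) :
    kroneckerAtPrime (d * (M : ℤ) ^ 2) p = kroneckerAtPrime d p := by
  unfold kroneckerAtPrime
  split_ifs with h2
  · subst h2
    have h1 : ∀ x : ZMod 8, ZMod.χ₈ (x * 1) = ZMod.χ₈ x := by decide
    have hM : ((M : ℤ) : ZMod 8) ^ 2 = 1 := by
      have : M % 8 = 1 ∨ M % 8 = 3 ∨ M % 8 = 5 ∨ M % 8 = 7 := by omega
      rw [Int.cast_natCast, ← ZMod.natCast_mod]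
      rcases this with h | h | h | h <;> rw [h] <;> rfl
    push_cast at hM ⊢
    rw [hM, h1]
  · have : Fact p.Prime := ⟨hp⟩
    rw [← jacobiSym.legendreSym.to_jacobiSym, ← jacobiSym.legendreSym.to_jacobiSym,
      legendreSym.mul, legendreSym.sq_one', mul_one]
    rwa [Int.cast_natCast, Ne, ZMod.natCast_eq_zero_iff]

namespace BinForm

/-! ### Forms with leading coefficient divisible by the level -/

theorem mem_Gamma0_iff {N : ℕ} {g : SL(2, ℤ)} :
    g ∈ CongruenceSubgroup.Gamma0 N ↔ (N : ℤ) ∣ g 1 0 := by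
  rw [CongruenceSubgroup.Gamma0_mem, CharP.intCast_eq_zero_iff (ZMod N) N]

/-- A primitive form properly represents an integer coprime to a given square-free `N`. -/
theorem exists_equivIn_top_a_isCoprime {D : ℤ} {N : ℕ} (hN : Squarefree N) {Q : BinForm}
    (hQ : Q ∈ primForms D) : ∃ Q', EquivIn ⊤ Q Q' ∧ IsCoprime Q'.a (N : ℤ) := by
  have hN0 : N ≠ 0 := hN.ne_zero
  -- a prime `p ∣ N` divides `y` iff `p ∤ a`, and divides `x` iff `p ∣ a` and `p ∤ c`
  set u := Nat.gcd Q.a.natAbs N with hu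
  obtain ⟨y, hy⟩ : u ∣ N := Nat.gcd_dvd_right _ _
  set v := Nat.gcd Q.c.natAbs u with hv
  obtain ⟨x, hx⟩ : v ∣ u := Nat.gcd_dvd_right _ _
  have huy : u.Coprime y := Nat.coprime_of_squarefree_mul (hy ▸ hN)
  have hvx : v.Coprime x := Nat.coprime_of_squarefree_mul
    (hx ▸ hN.squarefree_of_dvd (Nat.gcd_dvd_right _ _))
  have hxy : IsCoprime (x : ℤ) (y : ℤ) :=
    Nat.isCoprime_iff_coprime.2 (huy.coprime_dvd_left (hx ▸ dvd_mul_left _ _))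
  obtain ⟨r, s, hrs⟩ := hxy
  let g : SL(2, ℤ) := ⟨!![(x : ℤ), -s; (y : ℤ), r], by
    rw [Matrix.det_fin_two_of]; linear_combination hrs⟩
  refine ⟨Q.subst g, equivIn_iff.2 ⟨g, trivial, rfl⟩, ?_⟩
  have hga : (Q.subst g).a = Q.a * x ^ 2 + Q.b * x * y + Q.c * y ^ 2 := by simp [g, subst]
  rw [hga, Int.isCoprime_iff_gcd_eq_one]
  by_contra hne
  obtain ⟨p, hp, hd⟩ := Nat.exists_prime_and_dvd hne
  have hpi := Nat.prime_iff_prime_int.1 hp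
  have h1 : (p : ℤ) ∣ Q.a * x ^ 2 + Q.b * x * y + Q.c * y ^ 2 :=
    (Int.natCast_dvd_natCast.2 hd).trans (Int.gcd_dvd_left _ _)
  have h2 : p ∣ N := Int.natCast_dvd_natCast.1
    ((Int.natCast_dvd_natCast.2 hd).trans (Int.gcd_dvd_right _ _))
  by_cases ha : (p : ℤ) ∣ Q.a
  · have hpu : p ∣ u := Nat.dvd_gcd (Int.natCast_dvd.1 ha) h2
    have hpy : ¬ (p : ℤ) ∣ y := fun h => Nat.not_coprime_of_dvd_of_dvd hp.one_lt hpu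
      (Int.natCast_dvd_natCast.1 h) huy
    by_cases hc : (p : ℤ) ∣ Q.c
    · have hpv : p ∣ v := Nat.dvd_gcd (Int.natCast_dvd.1 hc) hpu
      have hpx : ¬ (p : ℤ) ∣ x := fun h => Nat.not_coprime_of_dvd_of_dvd hp.one_lt hpv
        (Int.natCast_dvd_natCast.1 h) hvx
      have hb : ¬ (p : ℤ) ∣ Q.b := fun hb => (gcd_coeffs_eq_one_iff Q).1 hQ.1.1 p hp ha hb hc
      have h3 : (p : ℤ) ∣ Q.b * x * y := by
        rw [show Q.b * x * y = Q.a * x ^ 2 + Q.b * x * y + Q.c * y ^ 2 - Q.a * x ^ 2 -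
          Q.c * y ^ 2 by ring]
        exact (h1.sub (ha.mul_right _)).sub (hc.mul_right _)
      rcases hpi.dvd_or_dvd h3 with h | h
      · rcases hpi.dvd_or_dvd h with h | h
        · exact hb h
        · exact hpx h
      · exact hpy h
    · have hpx : (p : ℤ) ∣ x := by
        have : p ∣ v * x := hx ▸ hpu
        refine Int.natCast_dvd_natCast.2 ((hp.dvd_mul.1 this).resolve_left fun h => hc ?_)
        exact Int.natCast_dvd.2 (h.trans (Nat.gcd_dvd_left _ _))
      have h3 : (p : ℤ) ∣ Q.c * y ^ 2 := by
        rw [show Q.c * y ^ 2 = Q.a * x ^ 2 + Q.b * x * y + Q.c * y ^ 2 -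
          x * (Q.a * x + Q.b * y) by ring]
        exact h1.sub (hpx.mul_right _)
      exact (hpi.dvd_or_dvd h3).elim hc fun h => hpy (hpi.dvd_of_dvd_pow h)
  · have hpy : p ∣ y := by
      have : p ∣ u * y := hy ▸ h2
      refine (hp.dvd_mul.1 this).resolve_left fun h => ha ?_
      exact Int.natCast_dvd.2 (h.trans (Nat.gcd_dvd_left _ _))
    have hpx : ¬ (p : ℤ) ∣ x := fun h => Nat.not_coprime_of_dvd_of_dvd hp.one_lt
      ((Int.natCast_dvd_natCast.1 h).trans (hx ▸ dvd_mul_left _ _)) hpy huy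
    have hpy' : (p : ℤ) ∣ y := Int.natCast_dvd_natCast.2 hpy
    have h3 : (p : ℤ) ∣ Q.a * x ^ 2 := by
      rw [show Q.a * x ^ 2 = Q.a * x ^ 2 + Q.b * x * y + Q.c * y ^ 2 -
        y * (Q.b * x + Q.c * y) by ring]
      exact h1.sub (hpy'.mul_right _)
    exact (hpi.dvd_or_dvd h3).elim ha fun h => hpx (hpi.dvd_of_dvd_pow h)

theorem gcd_eq_level_iff {a : ℤ} {N : ℕ} : Int.gcd a N = N ↔ (N : ℤ) ∣ a := by
  rw [Int.natCast_dvd]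
  exact Nat.gcd_eq_right_iff_dvd

theorem emod_four_of_mem_primForms {D : ℤ} {Q : BinForm} (hQ : Q ∈ primForms D) :
    D % 4 = 0 ∨ D % 4 = 1 := hQ.2 ▸ hQ.1.2.2.1

/-- Writing `b = D + 2 t`, the equation `b² - D = 4 a c` says that `t` takes the value `a c`
under the polynomial defining `discRoots`. -/
theorem exists_b_eq {D : ℤ} {Q : BinForm} (hQ : Q ∈ primForms D) :
    ∃ t, Q.b = D + 2 * t ∧ t ^ 2 + D * t + (D ^ 2 - D) / 4 = Q.a * Q.c := by
  have h4 := four_mul_ediv_sq_sub (emod_four_of_mem_primForms hQ)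
  have hd : Q.b ^ 2 - 4 * Q.a * Q.c = D := hQ.2
  have hpar : (Q.b - D) % 2 = 0 := by
    have h1 : Even (Q.b ^ 2 - D) := ⟨2 * Q.a * Q.c, by linear_combination hd⟩
    rw [Int.even_sub, Int.even_pow' two_ne_zero, ← Int.even_sub] at h1
    exact Int.even_iff.1 h1
  obtain ⟨t, ht⟩ := Int.dvd_of_emod_eq_zero hpar
  refine ⟨t, by linarith, ?_⟩
  have hb : Q.b = D + 2 * t := by linarith
  rw [hb] at hd
  have : 4 * (t ^ 2 + D * t + (D ^ 2 - D) / 4) = 4 * (Q.a * Q.c) := by linear_combination h4 + hd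
  linarith

/-- The class of `(b - D) / 2` modulo `N`, equivalently of `b` modulo `2 N`. For forms with
`N ∣ a` it is invariant under `Γ₀(N)`. -/
def rootMod (D : ℤ) (N : ℕ) (Q : BinForm) : ZMod N := ((Q.b - D) / 2 : ℤ)

theorem rootMod_eq {D t : ℤ} {N : ℕ} {Q : BinForm} (h : Q.b = D + 2 * t) :
    rootMod D N Q = (t : ZMod N) := by
  rw [rootMod, h, show (D + 2 * t - D) / 2 = t by omega]

theorem rootMod_mem_discRoots {D : ℤ} {N : ℕ} {Q : BinForm} (hQ : Q ∈ primForms D)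
    (ha : (N : ℤ) ∣ Q.a) : rootMod D N Q ∈ discRoots D N := by
  obtain ⟨t, ht, h⟩ := exists_b_eq hQ
  rw [rootMod_eq ht]
  change _ = _
  have h0 : (((Q.a * Q.c : ℤ)) : ZMod N) = 0 :=
    (CharP.intCast_eq_zero_iff (ZMod N) N _).2 (ha.mul_right _)
  rw [← h] at h0
  push_cast at h0 ⊢
  exact h0

theorem rootMod_subst {D : ℤ} {N : ℕ} {Q : BinForm} (hQ : Q ∈ primForms D)
    (ha : (N : ℤ) ∣ Q.a) {g : SL(2, ℤ)} (hg : g ∈ CongruenceSubgroup.Gamma0 N) :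
    rootMod D N (Q.subst g) = rootMod D N Q := by
  obtain ⟨t, ht, -⟩ := exists_b_eq hQ
  rw [mem_Gamma0_iff] at hg
  have hb : (Q.subst g).b = D + 2 * (t + (Q.a * (g 0 0 * g 0 1) +
      g 1 0 * (Q.b * g 0 1 + Q.c * g 1 1))) := by
    simp only [subst]
    linear_combination ht + Q.b * det_sl g
  rw [rootMod_eq ht, rootMod_eq hb, Int.cast_add, add_eq_left,
    CharP.intCast_eq_zero_iff (ZMod N) N]
  exact dvd_add (ha.mul_right _) (hg.mul_right _)

/-- An `SL₂(ℤ)`-equivalence of forms with `N ∣ a` and equal residues `b` modulo `2 N` lies in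
`Γ₀(N)`: comparing coefficients in `M γ = (γᵗ)⁻¹ M'`, the lower left entry `n` of `γ` satisfies
`N ∣ n a, n b, n c`. -/
theorem mem_Gamma0_of_rootMod_eq {D : ℤ} {N : ℕ} {Q Q' : BinForm} (hQ : Q ∈ primForms D)
    (hQ' : Q' ∈ primForms D) (ha : (N : ℤ) ∣ Q.a) (ha' : (N : ℤ) ∣ Q'.a)
    (hr : rootMod D N Q = rootMod D N Q') {g : SL(2, ℤ)} (h : Q' = Q.subst g) :
    g ∈ CongruenceSubgroup.Gamma0 N := by
  obtain ⟨t, ht, -⟩ := exists_b_eq hQ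
  obtain ⟨t', ht', -⟩ := exists_b_eq hQ'
  rw [rootMod_eq ht, rootMod_eq ht', ← sub_eq_zero, ← Int.cast_sub,
    CharP.intCast_eq_zero_iff (ZMod N) N] at hr
  rw [mem_Gamma0_iff]
  have hdet := det_sl g
  have e1 : Q'.a = _ := congrArg BinForm.a h
  have e2 : Q'.b = _ := congrArg BinForm.b h
  simp only [subst] at e1 e2
  rw [ht'] at e2
  have hb0 : Q.b = D + 2 * t := ht
  -- the entries of `M γ = (γᵗ)⁻¹ M'`
  have f1 : g 1 0 * Q.b = g 1 1 * Q'.a - g 0 0 * Q.a + g 1 0 * (t - t') := by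
    have : 2 * (g 1 0 * Q.b) = 2 * (g 1 1 * Q'.a - g 0 0 * Q.a + g 1 0 * (t - t')) := by
      rw [e1]
      linear_combination (-2 * Q.a * g 0 0 - Q.b * g 1 0) * hdet + g 1 0 * hb0 + g 1 0 * e2
    linarith
  have f2 : g 1 0 * Q.c = (t' - t) * g 0 0 - g 0 1 * Q'.a := by
    have : 2 * (g 1 0 * Q.c) = 2 * ((t' - t) * g 0 0 - g 0 1 * Q'.a) := by
      rw [e1]
      linear_combination (-2 * Q.c * g 1 0 - Q.b * g 0 0) * hdet - g 0 0 * hb0 - g 0 0 * e2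
    linarith
  refine dvd_of_dvd_mul_coeffs hQ.1.1 (ha.mul_left _) ?_ ?_
  · rw [f1]
    exact ((ha'.mul_left _).sub (ha.mul_left _)).add (hr.mul_left _)
  · rw [f2, ← neg_sub t t']
    exact ((hr.neg_right).mul_right _).sub (ha'.mul_left _)

/-- Every class contains a form with `N ∣ a` and any prescribed root: start from a form with `a`
coprime to `N`, move `b` by a translation to `-β` modulo `2 N`, and swap the variables. -/
theorem exists_equivIn_top_rootMod_eq {D : ℤ} {N : ℕ} (hN : Squarefree N) {Q : BinForm}
    (hQ : Q ∈ primForms D) {r : ZMod N} (hr : r ∈ discRoots D N) :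
    ∃ Q', EquivIn ⊤ Q Q' ∧ (N : ℤ) ∣ Q'.a ∧ rootMod D N Q' = r := by
  obtain ⟨R, hR, u, v, huv⟩ := exists_equivIn_top_a_isCoprime hN hQ
  obtain ⟨t, ht, -⟩ := exists_b_eq (mem_primForms_of_equivIn hQ hR)
  obtain ⟨s, rfl⟩ := ZMod.intCast_surjective r
  -- the translation length `n = u (-D - t - s)` makes `R.b + 2 R.a n ≡ -(D + 2 s) (mod 2 N)`
  have hT := (hR.trans (equivIn_top_translate R (u * (-D - t - s)))).trans (equivIn_top_swap _)
  have hT' := mem_primForms_of_equivIn hQ hT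
  refine ⟨_, hT, ?_, ?_⟩
  · obtain ⟨t', ht', h'⟩ := exists_b_eq hT'
    have htt : t' = s + N * (v * (-D - t - s)) := by
      simp only at ht'
      have : 2 * t' = 2 * (s + N * (v * (-D - t - s))) := by
        linear_combination -ht' - 2 * (-D - t - s) * huv - ht
      linarith
    have hdvd : (N : ℤ) ∣ t' ^ 2 + D * t' + (D ^ 2 - D) / 4 := by
      rw [← CharP.intCast_eq_zero_iff (ZMod N) N]
      have : (t' : ZMod N) = s := by rw [htt]; push_cast; simp
      push_cast
      rw [this]
      exact hr
    rw [h'] at hdvd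
    exact IsCoprime.dvd_of_dvd_mul_right (IsCoprime.symm ⟨u, v, huv⟩) hdvd
  · rw [rootMod_eq (t := s + N * (v * (-D - t - s)))]
    · push_cast; simp
    · simp only
      linear_combination -2 * (-D - t - s) * huv - ht

/-- The `SL₂(ℤ)`-class and the root modulo `N` of a `Γ₀(N)`-class of forms with `N ∣ a`. -/
def classAndRoot (D : ℤ) (N : ℕ) : Classes (CongruenceSubgroup.Gamma0 N) (primFormsGcd D N N) →
    Classes ⊤ (primForms D) × discRoots D N :=
  Quotient.lift (s := equivSetoid _ _)
    (fun Q => (Quotient.mk (equivSetoid _ _) ⟨Q.1, Q.2.1⟩,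
      ⟨rootMod D N Q.1, rootMod_mem_discRoots Q.2.1 (gcd_eq_level_iff.1 Q.2.2)⟩)) (by
    intro Q Q' h
    obtain ⟨g, hg, e⟩ := equivIn_iff.1 (show EquivIn _ Q.1 Q'.1 from h)
    refine Prod.ext (Quotient.sound (s := equivSetoid _ _) (equivIn_top h)) (Subtype.ext ?_)
    change rootMod D N Q.1 = rootMod D N Q'.1
    rw [e, rootMod_subst Q.2.1 (gcd_eq_level_iff.1 Q.2.2) hg])

theorem classAndRoot_bijective (D : ℤ) {N : ℕ} (hN : Squarefree N) :
    Function.Bijective (classAndRoot D N) := by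
  constructor
  · intro q q'
    refine Quotient.inductionOn₂ q q' fun Q Q' h => ?_
    have h1 : Quotient.mk (equivSetoid ⊤ (primForms D)) ⟨Q.1, Q.2.1⟩ =
        Quotient.mk (equivSetoid ⊤ (primForms D)) ⟨Q'.1, Q'.2.1⟩ := congrArg Prod.fst h
    have h2 : rootMod D N Q.1 = rootMod D N Q'.1 := congrArg (fun x => (Prod.snd x).1) h
    have h3 := Quotient.exact (s := equivSetoid _ _) h1
    obtain ⟨g, -, e⟩ := equivIn_iff.1 (show EquivIn ⊤ Q.1 Q'.1 from h3)
    exact Quotient.sound (s := equivSetoid _ _) (equivIn_iff.2 ⟨g, mem_Gamma0_of_rootMod_eq Q.2.1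
      Q'.2.1 (gcd_eq_level_iff.1 Q.2.2) (gcd_eq_level_iff.1 Q'.2.2) h2 e, e⟩)
  · rintro ⟨q, r, hr⟩
    induction q using Quotient.inductionOn with
    | h Q =>
      obtain ⟨Q', hQ', ha, rfl⟩ := exists_equivIn_top_rootMod_eq hN Q.2 hr
      exact ⟨Quotient.mk (equivSetoid _ _)
        ⟨Q', mem_primForms_of_equivIn Q.2 hQ', gcd_eq_level_iff.2 ha⟩,
        Prod.ext (Quotient.sound (s := equivSetoid _ _) hQ'.symm) rfl⟩

end BinForm

theorem mul_sq_mem_Omega {d : ℤ} (hd : d ∈ Omega) {M : ℕ} (hM : M ≠ 0) :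
    d * (M : ℤ) ^ 2 ∈ Omega := by
  obtain ⟨h0, h4, hs⟩ := hd
  refine ⟨by positivity, ?_, ?_⟩
  · have hM4 : (M : ℤ) ^ 2 % 4 = 0 ∨ (M : ℤ) ^ 2 % 4 = 1 := by
      rcases Int.emod_two_eq_zero_or_one M with h | h
      · left; obtain ⟨t, ht⟩ := Int.dvd_of_emod_eq_zero h
        rw [ht, show (2 * t) ^ 2 = 4 * t ^ 2 by ring]; omega
      · right; exact Int.sq_mod_four_eq_one_of_odd (Int.odd_iff.2 h)
    rw [Int.mul_emod]
    rcases h4 with h | h <;> rcases hM4 with h' | h' <;> simp [h, h']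
  · rintro ⟨r, hr⟩
    have hdvd : (M : ℤ) ^ 2 ∣ r ^ 2 := ⟨d, by linear_combination -hr⟩
    obtain ⟨s, rfl⟩ := (Int.pow_dvd_pow_iff two_ne_zero).1 hdvd
    refine hs ⟨s, mul_right_cancel₀ (pow_ne_zero 2 (Int.natCast_ne_zero.2 hM)) ?_⟩
    linear_combination hr

namespace BinForm

/-! ### The Atkin–Lehner substitution -/

theorem subst_smul (Q : BinForm) (m : ℤ) (A : Matrix (Fin 2) (Fin 2) ℤ) :
    Q.subst (m • A) = ⟨m ^ 2 * (Q.subst A).a, m ^ 2 * (Q.subst A).b, m ^ 2 * (Q.subst A).c⟩ := by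
  ext <;> simp only [subst, Matrix.smul_apply, smul_eq_mul] <;> ring

theorem eq_of_subst_smul_eq {Q Q' : BinForm} {m : ℤ} (hm : m ≠ 0)
    {A B : Matrix (Fin 2) (Fin 2) ℤ} (h : Q.subst (m • A) = Q'.subst (m • B)) :
    Q.subst A = Q'.subst B := by
  have hm2 := pow_ne_zero 2 hm
  rw [subst_smul, subst_smul, BinForm.mk.injEq] at h
  exact BinForm.ext (mul_left_cancel₀ hm2 h.1) (mul_left_cancel₀ hm2 h.2.1)
    (mul_left_cancel₀ hm2 h.2.2)

/-- The matrices of the Atkin–Lehner involution `W_M` at level `k * M`; they are used under the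
condition `M x w - k y z = 1`, which makes the determinant `M`. -/
def atkinLehner (k M x y z w : ℤ) : Matrix (Fin 2) (Fin 2) ℤ := !![M * x, y; k * M * z, M * w]

theorem det_atkinLehner {k M x y z w : ℤ} (h : M * x * w - k * y * z = 1) :
    (atkinLehner k M x y z w).det = M := by
  rw [atkinLehner, Matrix.det_fin_two_of]
  linear_combination M * h

theorem atkinLehner_mul_adjugate {k M x y z w : ℤ} (h : M * x * w - k * y * z = 1) :
    atkinLehner k M x y z w * atkinLehner k M w (-y) (-z) x = M • 1 := by
  ext i j
  fin_cases i <;> fin_cases j <;>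
    simp [atkinLehner, Matrix.mul_apply, Fin.sum_univ_two]
  · linear_combination M * h
  · ring
  · ring
  · linear_combination M * h

/-- An Atkin–Lehner matrix normalizes `Γ₀(k M)`. -/
theorem exists_mul_atkinLehner_eq {k M : ℕ} {x y z w : ℤ} (h : M * x * w - k * y * z = 1)
    {g : SL(2, ℤ)} (hg : g ∈ CongruenceSubgroup.Gamma0 (k * M)) :
    ∃ g' ∈ CongruenceSubgroup.Gamma0 (k * M),
      (g : Matrix (Fin 2) (Fin 2) ℤ) * atkinLehner k M x y z w =
        atkinLehner k M x y z w * (g' : SL(2, ℤ)) := by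
  obtain ⟨γ, hγ⟩ := mem_Gamma0_iff.1 hg
  have hdet := det_sl g
  push_cast at hγ
  rw [hγ] at hdet
  set α := g 0 0 with hα
  set β := g 0 1 with hβ
  set δ := g 1 1 with hδ
  refine ⟨⟨!![w * (α * M * x + β * k * M * z) - y * (k * γ * M * x + δ * k * z),
    w * (α * y + β * M * w) - y * (k * γ * y + δ * w);
    k * M * (-z * (α * x + β * k * z) + x * (γ * M * x + δ * z)),
    -k * z * (α * y + β * M * w) + x * (k * M * γ * y + δ * M * w)], ?_⟩, ?_, ?_⟩
  · rw [Matrix.det_fin_two_of]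
    linear_combination (M * x * w - k * y * z) ^ 2 * hdet + (M * x * w - k * y * z + 1) * h
  · refine mem_Gamma0_iff.2 ?_
    push_cast
    exact ⟨_, rfl⟩
  · ext i j
    fin_cases i <;> fin_cases j <;>
      simp [atkinLehner, Matrix.mul_apply, Fin.sum_univ_two, hγ, ← hα, ← hβ, ← hδ]
    · linear_combination -(α * M * x + β * k * M * z) * h
    · linear_combination -(α * y + β * M * w) * h
    · linear_combination -(k * M * γ * M * x + δ * k * M * z) * h
    · linear_combination -(k * M * γ * y + δ * M * w) * h

theorem isCoprime_natCast_of_forall_prime {M : ℕ} {a : ℤ}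
    (h : ∀ p : ℕ, p.Prime → p ∣ M → ¬ (p : ℤ) ∣ a) : IsCoprime (M : ℤ) a := by
  rw [Int.isCoprime_iff_gcd_eq_one]
  by_contra hne
  obtain ⟨p, hp, hd⟩ := Nat.exists_prime_and_dvd hne
  have hd' := Int.natCast_dvd_natCast.2 hd
  exact h p hp (Int.natCast_dvd_natCast.1 (hd'.trans (Int.gcd_dvd_left _ _)))
    (hd'.trans (Int.gcd_dvd_right _ _))

/-- The step from `M² ∣ 4 a` to `M² ∣ a`, immediate for odd `M`. For even `M` it uses that
`b² - d` is a multiple of `4` as soon as it is even. -/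
theorem sq_dvd_of_four_mul_eq {M : ℕ} {a d b c : ℤ} (hM : Squarefree M) (ha : (M : ℤ) ∣ a)
    (hc : IsCoprime (M : ℤ) c) (hd : d % 4 = 0 ∨ d % 4 = 1)
    (h : 4 * a * c = (M : ℤ) ^ 2 * (b ^ 2 - d)) : (M : ℤ) ^ 2 ∣ a := by
  have h4 : (M : ℤ) ^ 2 ∣ 4 * a :=
    (hc.pow_left (m := 2)).dvd_of_dvd_mul_right ⟨_, h⟩
  rcases Nat.even_or_odd M with he | ho
  · obtain ⟨m, rfl⟩ := he.two_dvd
    have hm2 : IsCoprime (2 : ℤ) m :=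
      Nat.isCoprime_iff_coprime.2 (Nat.coprime_of_squarefree_mul hM)
    push_cast at h h4 hc ha ⊢
    have hc2 : IsCoprime (2 : ℤ) c := hc.of_mul_left_left
    have hm0 : (m : ℤ) ≠ 0 := by
      rintro h0
      rw [Int.natCast_eq_zero] at h0
      subst h0; exact hM.ne_zero rfl
    obtain ⟨a', rfl⟩ : (m : ℤ) ^ 2 ∣ a := by
      obtain ⟨s, hs⟩ := h4
      exact ⟨s, by linarith⟩
    have h' : a' * c = b ^ 2 - d := by
      apply mul_left_cancel₀ (pow_ne_zero 2 hm0)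
      linarith
    have ha2 : (2 : ℤ) ∣ a' := by
      obtain ⟨s, hs⟩ := ha
      refine hm2.dvd_of_dvd_mul_left ⟨s, mul_left_cancel₀ hm0 ?_⟩
      linear_combination hs
    -- `b ^ 2 - d` is even, hence divisible by `4` as `d ≡ 0, 1 (mod 4)`
    have hb4 : (4 : ℤ) ∣ b ^ 2 - d := by
      have h2 : (2 : ℤ) ∣ b ^ 2 - d := h' ▸ ha2.mul_right c
      rcases Int.even_or_odd b with hb | hb
      · obtain ⟨t, rfl⟩ := hb.two_dvd
        rw [show (2 * t) ^ 2 = 4 * t ^ 2 by ring] at h2 ⊢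
        omega
      · have := Int.sq_mod_four_eq_one_of_odd hb
        omega
    rw [← h'] at hb4
    have hc4 : IsCoprime (4 : ℤ) c := hc2.pow_left (m := 2)
    obtain ⟨s, rfl⟩ := hc4.dvd_of_dvd_mul_right hb4
    exact ⟨s, by ring⟩
  · have hM2 : IsCoprime ((M : ℤ) ^ 2) 4 := by
      have : IsCoprime (M : ℤ) 2 := Nat.isCoprime_iff_coprime.2 ho.coprime_two_right
      exact (this.pow (m := 2) (n := 2))
    exact hM2.dvd_of_dvd_mul_left h4

section

variable {d : ℤ} {k M : ℕ} {x z : ℤ}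

theorem subst_atkinLehner_mem (hM : M ≠ 0) (hk : k.Coprime M) (h : M * x - k * z = 1)
    {Q : BinForm} (hQ : Q ∈ primFormsGcd d (k * M) k) :
    Q.subst (atkinLehner k M x 1 z 1) ∈
      primFormsGcd (d * (M : ℤ) ^ 2) (k * M) (k * M) := by
  have h' : (M : ℤ) * x * 1 - k * 1 * z = 1 := by linear_combination h
  obtain ⟨hp, hgcd⟩ := hQ
  have hdisc : (Q.subst (atkinLehner k M x 1 z 1)).disc = d * (M : ℤ) ^ 2 := by
    rw [disc_subst, det_atkinLehner h', hp.2]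
  have hka : (k : ℤ) ∣ Q.a := by
    have := Int.gcd_dvd_left Q.a ((k * M : ℕ) : ℤ)
    rwa [hgcd] at this
  refine ⟨⟨⟨?_, ?_⟩, hdisc⟩, gcd_eq_level_iff.2 ?_⟩
  · rw [gcd_coeffs_eq_one_iff]
    intro p hpp ha hb hc
    by_cases hpM : p ∣ M
    · have hpa : (p : ℤ) ∣ Q.a := by
        have : Q.a = (Q.subst (atkinLehner k M x 1 z 1)).c - M * (Q.b + Q.c * M) := by
          simp only [subst, atkinLehner]; simp; ring
        rw [this]
        exact hc.sub ((Int.natCast_dvd_natCast.2 hpM).mul_right _)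
      have hpk : p ∣ k := by
        rw [← hgcd]
        exact Nat.dvd_gcd (Int.natCast_dvd.1 hpa) (hpM.trans (dvd_mul_left _ _))
      exact Nat.not_coprime_of_dvd_of_dvd hpp.one_lt hpk hpM hk
    · have key := dvd_subst ha hb hc (atkinLehner k M 1 (-1) (-z) x)
      rw [subst_subst, atkinLehner_mul_adjugate h', subst_smul, subst_one] at key
      have hpi := Nat.prime_iff_prime_int.1 hpp
      have hpM2 : ¬ (p : ℤ) ∣ (M : ℤ) ^ 2 := fun hh =>
        hpM (Int.natCast_dvd_natCast.1 (hpi.dvd_of_dvd_pow hh))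
      exact (gcd_coeffs_eq_one_iff Q).1 hp.1.1 p hpp ((hpi.dvd_or_dvd key.1).resolve_left hpM2)
        ((hpi.dvd_or_dvd key.2.1).resolve_left hpM2) ((hpi.dvd_or_dvd key.2.2).resolve_left hpM2)
  · rw [hdisc]
    exact mul_sq_mem_Omega (hp.2 ▸ hp.1.2) hM
  · obtain ⟨a', ha'⟩ := hka
    push_cast
    refine ⟨M * (a' * x ^ 2 + Q.b * x * z + Q.c * k * z ^ 2), ?_⟩
    simp only [subst, atkinLehner]
    simp [ha']
    ring

theorem exists_subst_atkinLehner_eq (hM : Squarefree M) (h : M * x - k * z = 1)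
    (hd : d ∈ Omega) {F : BinForm}
    (hF : F ∈ primFormsGcd (d * (M : ℤ) ^ 2) (k * M) (k * M)) :
    ∃ Q ∈ primFormsGcd d (k * M) k, Q.subst (atkinLehner k M x 1 z 1) = F := by
  obtain ⟨hp, hgcd⟩ := hF
  have hNa := gcd_eq_level_iff.1 hgcd
  push_cast at hNa
  have hka : (k : ℤ) ∣ F.a := (dvd_mul_right _ _).trans hNa
  have hMa : (M : ℤ) ∣ F.a := (dvd_mul_left _ _).trans hNa
  have hM0 : (M : ℤ) ^ 2 ≠ 0 := pow_ne_zero 2 (Int.natCast_ne_zero.2 hM.ne_zero)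
  have hdisc : F.b ^ 2 - 4 * F.a * F.c = d * (M : ℤ) ^ 2 := hp.2
  obtain ⟨b', hb'⟩ : (M : ℤ) ∣ F.b := by
    rw [← (Int.squarefree_natCast.2 hM).dvd_pow_iff_dvd two_ne_zero,
      show F.b ^ 2 = F.a * (4 * F.c) + M * (d * M) by linear_combination hdisc]
    exact (hMa.mul_right _).add (dvd_mul_right _ _)
  have hcop : ∀ p : ℕ, p.Prime → p ∣ M → ¬ (p : ℤ) ∣ F.c := fun p hpp hpM =>
    (gcd_coeffs_eq_one_iff F).1 hp.1.1 p hpp ((Int.natCast_dvd_natCast.2 hpM).trans hMa)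
      (hb' ▸ (Int.natCast_dvd_natCast.2 hpM).mul_right _)
  obtain ⟨a', ha'⟩ := sq_dvd_of_four_mul_eq (b := b') hM hMa
    (isCoprime_natCast_of_forall_prime hcop) hd.2.1
    (by rw [hb'] at hdisc; linear_combination -hdisc)
  -- the coefficients of `F ∘ adj W`, divided by `M ^ 2`
  let Q : BinForm := ⟨F.a - F.b * k * z + F.c * k ^ 2 * z ^ 2,
    -2 * M * a' + b' * (M * x + k * z) - 2 * F.c * k * z * x, a' - b' * x + F.c * x ^ 2⟩
  have hQF : Q.subst (atkinLehner k M x 1 z 1) = F := by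
    ext
    · simp [subst, atkinLehner, Q, ha', hb']
      linear_combination (M ^ 2 * a' * (M * x - k * z + 1)) * h
    · simp [subst, atkinLehner, Q, ha', hb']
      linear_combination (M * b' * (M * x - k * z + 1)) * h
    · simp [subst, atkinLehner, Q, ha', hb']
      linear_combination (F.c * (M * x - k * z + 1)) * h
  have hQdisc : Q.disc = d := by
    have := congrArg disc hQF
    rw [disc_subst, det_atkinLehner (by linear_combination h), hp.2] at this
    exact mul_right_cancel₀ hM0 this
  refine ⟨Q, ⟨⟨⟨?_, hQdisc ▸ hd⟩, hQdisc⟩, ?_⟩, hQF⟩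
  · rw [gcd_coeffs_eq_one_iff]
    intro p hpp ha hb hc
    have key := dvd_subst ha hb hc (atkinLehner k M x 1 z 1)
    rw [hQF] at key
    exact (gcd_coeffs_eq_one_iff F).1 hp.1.1 p hpp key.1 key.2.1 key.2.2
  · have hkQ : (k : ℤ) ∣ Q.a := by
      change (k : ℤ) ∣ F.a - F.b * k * z + F.c * k ^ 2 * z ^ 2
      rw [show F.a - F.b * k * z + F.c * k ^ 2 * z ^ 2 =
        F.a + k * (-F.b * z + F.c * k * z ^ 2) by ring]
      exact hka.add (dvd_mul_right _ _)
    have hMQ : IsCoprime (M : ℤ) Q.a := isCoprime_natCast_of_forall_prime fun p hpp hpM hpa => by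
      apply hcop p hpp hpM
      have : F.c = Q.a + M * (Q.b + Q.c * M) := by
        rw [← congrArg BinForm.c hQF]; simp [subst, atkinLehner]; ring
      rw [this]
      exact hpa.add ((Int.natCast_dvd_natCast.2 hpM).mul_right _)
    refine Nat.dvd_antisymm ?_ (Nat.dvd_gcd (Int.natCast_dvd.1 hkQ) (dvd_mul_right _ _))
    refine Nat.Coprime.dvd_of_dvd_mul_right ?_ (Nat.gcd_dvd_right _ _)
    refine Nat.Coprime.coprime_dvd_left (Nat.gcd_dvd_left _ _) ?_
    rw [Nat.coprime_comm, Nat.Coprime]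
    exact Int.isCoprime_iff_gcd_eq_one.1 hMQ

theorem equivIn_subst_atkinLehner_iff (hM : M ≠ 0) (h : M * x - k * z = 1) {Q Q' : BinForm} :
    EquivIn (CongruenceSubgroup.Gamma0 (k * M)) (Q.subst (atkinLehner k M x 1 z 1))
      (Q'.subst (atkinLehner k M x 1 z 1)) ↔ EquivIn (CongruenceSubgroup.Gamma0 (k * M)) Q Q' := by
  have h' : (M : ℤ) * x * 1 - k * 1 * z = 1 := by linear_combination h
  have h'' : (M : ℤ) * 1 * x - k * -1 * -z = 1 := by linear_combination h
  rw [equivIn_iff, equivIn_iff]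
  constructor
  · rintro ⟨g, hg, e⟩
    obtain ⟨g', hg', hc⟩ := exists_mul_atkinLehner_eq h'' hg
    refine ⟨g', hg', ?_⟩
    rw [← Q'.subst_one]
    apply eq_of_subst_smul_eq (m := M) (Int.natCast_ne_zero.2 hM)
    rw [← atkinLehner_mul_adjugate h', ← subst_subst, e, subst_subst, subst_subst,
      hc, ← Matrix.mul_assoc, atkinLehner_mul_adjugate h', Matrix.smul_mul,
      Matrix.one_mul]
  · rintro ⟨g, hg, rfl⟩
    obtain ⟨g', hg', hc⟩ := exists_mul_atkinLehner_eq h' hg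
    exact ⟨g', hg', by rw [subst_subst, hc, subst_subst]⟩

end

/-- The Atkin–Lehner substitution identifies the `Γ₀(k M)`-classes of discriminant `d` and
`(a, k M) = k` with those of discriminant `d M²` and `k M ∣ a`. -/
theorem nonempty_classes_primFormsGcd_equiv {d : ℤ} (hd : d ∈ Omega) {k M : ℕ}
    (hM : Squarefree M) (hk : k.Coprime M) :
    Nonempty (Classes (CongruenceSubgroup.Gamma0 (k * M)) (primFormsGcd d (k * M) k) ≃
      Classes (CongruenceSubgroup.Gamma0 (k * M))
        (primFormsGcd (d * (M : ℤ) ^ 2) (k * M) (k * M))) := by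
  obtain ⟨u, v, huv⟩ := Nat.isCoprime_iff_coprime.2 hk
  have h : (M : ℤ) * v - k * (-u) = 1 := by linear_combination huv
  have hM0 := hM.ne_zero
  let f : primFormsGcd d (k * M) k → primFormsGcd (d * (M : ℤ) ^ 2) (k * M) (k * M) :=
    fun Q => ⟨_, subst_atkinLehner_mem hM0 hk h Q.2⟩
  refine ⟨Equiv.ofBijective (Quotient.map (sa := equivSetoid _ _) (sb := equivSetoid _ _) f
    fun Q Q' hQ => (equivIn_subst_atkinLehner_iff hM0 h).2 hQ) ⟨?_, ?_⟩⟩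
  · intro q q'
    refine Quotient.inductionOn₂ q q' fun Q Q' e => ?_
    have e' : Quotient.mk (equivSetoid _ _) (f Q) = Quotient.mk (equivSetoid _ _) (f Q') := e
    have e'' := Quotient.exact (s := equivSetoid _ _) e'
    exact Quotient.sound (s := equivSetoid _ _) ((equivIn_subst_atkinLehner_iff hM0 h).1 e'')
  · intro q
    induction q using Quotient.inductionOn with
    | h F =>
      obtain ⟨Q, hQ, e⟩ := exists_subst_atkinLehner_eq hM h hd F.2
      exact ⟨Quotient.mk (equivSetoid _ _) ⟨Q, hQ⟩,
        congrArg (Quotient.mk (equivSetoid _ _)) (Subtype.ext e)⟩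

/-! ### Counting classes -/

theorem gcd_a_eq_of_equivIn {N : ℕ} {Q Q' : BinForm}
    (h : EquivIn (CongruenceSubgroup.Gamma0 N) Q Q') : Int.gcd Q.a N = Int.gcd Q'.a N := by
  have key : ∀ {Q Q' : BinForm}, EquivIn (CongruenceSubgroup.Gamma0 N) Q Q' →
      Int.gcd Q.a N ∣ Int.gcd Q'.a N := by
    intro Q Q' h
    obtain ⟨g, hg, rfl⟩ := equivIn_iff.1 h
    rw [mem_Gamma0_iff] at hg
    have hN := Int.gcd_dvd_right Q.a (N : ℤ)
    refine Int.dvd_gcd ?_ hN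
    rw [show (Q.subst g).a = Q.a * g 0 0 ^ 2 + g 1 0 * (Q.b * g 0 0 + Q.c * g 1 0) by
      simp only [subst]; ring]
    exact ((Int.gcd_dvd_left Q.a (N : ℤ)).mul_right _).add ((hN.trans hg).mul_right _)
  exact Nat.dvd_antisymm (key h) (key h.symm)

/-- The `Γ₀(N)`-classes of discriminant `d`, sorted by the invariant `(a, N)`. -/
theorem nonempty_sigma_classes_equiv (d : ℤ) {N : ℕ} (hN : N ≠ 0) :
    Nonempty ((Σ k : N.divisors, Classes (CongruenceSubgroup.Gamma0 N) (primFormsGcd d N k)) ≃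
      Classes (CongruenceSubgroup.Gamma0 N) (primForms d)) := by
  let f (k : N.divisors) (Q : primFormsGcd d N k) : primForms d := ⟨Q.1, Q.2.1⟩
  let F (k : N.divisors) : Classes (CongruenceSubgroup.Gamma0 N) (primFormsGcd d N k) →
      Classes (CongruenceSubgroup.Gamma0 N) (primForms d) :=
    Quotient.map (sa := equivSetoid _ _) (sb := equivSetoid _ _) (f k) fun _ _ h => h
  refine ⟨Equiv.ofBijective (fun x => F x.1 x.2) ⟨?_, ?_⟩⟩
  · rintro ⟨k, q⟩ ⟨k', q'⟩
    refine Quotient.inductionOn₂ q q' fun Q Q' e => ?_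
    have e' : Quotient.mk (equivSetoid _ _) (f k Q) = Quotient.mk (equivSetoid _ _) (f k' Q') := e
    have e'' := Quotient.exact (s := equivSetoid _ _) e'
    have h : EquivIn (CongruenceSubgroup.Gamma0 N) Q.1 Q'.1 := e''
    obtain rfl : k = k' := Subtype.ext (by rw [← Q.2.2, ← Q'.2.2, gcd_a_eq_of_equivIn h])
    exact congrArg (Sigma.mk k) (Quotient.sound (s := equivSetoid _ _) h)
  · intro q
    induction q using Quotient.inductionOn with
    | h Q =>
      exact ⟨⟨⟨Int.gcd Q.1.a N, Nat.mem_divisors.2 ⟨Nat.gcd_dvd_right _ _, hN⟩⟩,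
        Quotient.mk (equivSetoid _ _) ⟨Q.1, Q.2, rfl⟩⟩, rfl⟩

theorem prod_kroneckerAtPrime_mul_sq (d : ℤ) {k M : ℕ} (hk : k.Coprime M) :
    ∏ p ∈ (k * M).primeFactors, (1 + kroneckerAtPrime (d * (M : ℤ) ^ 2) p) =
      ∏ p ∈ k.primeFactors, (1 + kroneckerAtPrime d p) := by
  rw [hk.primeFactors_mul, Finset.prod_union hk.disjoint_primeFactors]
  have h1 : ∏ p ∈ M.primeFactors, (1 + kroneckerAtPrime (d * (M : ℤ) ^ 2) p) = 1 :=
    Finset.prod_eq_one fun p hp => by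
      rw [kroneckerAtPrime_mul_sq_of_dvd d (Nat.prime_of_mem_primeFactors hp)
        (Nat.dvd_of_mem_primeFactors hp), add_zero]
  rw [h1, mul_one]
  refine Finset.prod_congr rfl fun p hp => ?_
  have hpp := Nat.prime_of_mem_primeFactors hp
  rw [kroneckerAtPrime_mul_sq_of_not_dvd d hpp fun h =>
    Nat.not_coprime_of_dvd_of_dvd hpp.one_lt (Nat.dvd_of_mem_primeFactors hp) h hk]

theorem finite_and_card_classes_primFormsGcd {d : ℤ} (hd : d ∈ Omega) {N k : ℕ}
    (hN : Squarefree N) (hkN : k ∣ N) :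
    Finite (Classes (CongruenceSubgroup.Gamma0 N) (primFormsGcd d N k)) ∧
      (Nat.card (Classes (CongruenceSubgroup.Gamma0 N) (primFormsGcd d N k)) : ℤ) =
        (classNumber (d * ((N / k : ℕ) : ℤ) ^ 2) : ℤ) *
          ∏ p ∈ k.primeFactors, (1 + kroneckerAtPrime d p) := by
  obtain ⟨M, rfl⟩ := hkN
  have hk := Nat.coprime_of_squarefree_mul hN
  have hM := hN.squarefree_of_dvd (dvd_mul_left M k)
  have hk0 : 0 < k := Nat.pos_of_ne_zero (left_ne_zero_of_mul hN.ne_zero)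
  rw [Nat.mul_div_cancel_left M hk0]
  obtain ⟨e⟩ := nonempty_classes_primFormsGcd_equiv hd hM hk
  let e' := e.trans (Equiv.ofBijective _ (classAndRoot_bijective (d * (M : ℤ) ^ 2) hN))
  have : NeZero (k * M) := ⟨hN.ne_zero⟩
  have := finite_classes_top (d * (M : ℤ) ^ 2)
  refine ⟨Finite.of_equiv _ e'.symm, ?_⟩
  rw [Nat.card_congr e', Nat.card_prod, Nat.cast_mul, classNumber,
    card_discRoots (mul_sq_mem_Omega hd hM.ne_zero).2.1 hN, prod_kroneckerAtPrime_mul_sq d hk]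

end BinForm

theorem lemma4p5 (N : ℕ) (hN : Squarefree N) (d : ℤ) (hd : d ∈ Omega) :
    (∀ k : ℕ, k ∣ N →
      Finite (BinForm.Classes ⊤ (BinForm.primForms (d * ((N / k : ℕ) : ℤ) ^ 2))) ∧
      Finite (BinForm.Classes (CongruenceSubgroup.Gamma0 N) (BinForm.primFormsGcd d N k)) ∧
      (Nat.card (BinForm.Classes (CongruenceSubgroup.Gamma0 N)
          (BinForm.primFormsGcd d N k)) : ℤ) =
        (BinForm.classNumber (d * ((N / k : ℕ) : ℤ) ^ 2) : ℤ) *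
          ∏ p ∈ k.primeFactors, (1 + kroneckerAtPrime d p)) ∧
    Finite (BinForm.Classes (CongruenceSubgroup.Gamma0 N) (BinForm.primForms d)) ∧
    (BinForm.levelClassNumber N d : ℤ) =
      ∑ k ∈ N.divisors, (BinForm.classNumber (d * ((N / k : ℕ) : ℤ) ^ 2) : ℤ) *
        ∏ p ∈ k.primeFactors, (1 + kroneckerAtPrime d p) := by
  have key : ∀ k : ℕ, k ∣ N → _ := fun k hk =>
    BinForm.finite_and_card_classes_primFormsGcd (k := k) hd hN hk
  obtain ⟨e⟩ := BinForm.nonempty_sigma_classes_equiv d hN.ne_zero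
  have hfin : ∀ k : N.divisors, Finite (BinForm.Classes (CongruenceSubgroup.Gamma0 N)
      (BinForm.primFormsGcd d N k)) := fun k => (key k (Nat.dvd_of_mem_divisors k.2)).1
  refine ⟨fun k hk => ⟨BinForm.finite_classes_top _, key k hk⟩, Finite.of_equiv _ e, ?_⟩
  rw [BinForm.levelClassNumber, ← Nat.card_congr e, Nat.card_sigma, Nat.cast_sum,
    ← Finset.sum_coe_sort N.divisors]
  exact Finset.sum_congr rfl fun k _ => (key k (Nat.dvd_of_mem_divisors k.2)).2
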